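/- Write $[M]=\{0,1,\dots,M-1\}$. A set $X\subseteq[M]^n$ is called symmetric if $(x_{\sigma(1)},\dots,x_{\sigma(n)})\in X$ for all $x\in X$ and $\sigma\in S_n$, and a function $f:X\to\{0,1\}$ on a symmetric set $X$ is called symmetric if $f(x_{\sigma(1)},\dots,x_{\sigma(n)})=f(x)$ for all $x\in X$ and $\sigma\in S_n$ (so that $f(x)$ depends only on the type of $x$, i.e. on the multiset $\{x_1,\dots,x_n\}$). Let $R(f)$ and $Q(f)$ denote the bounded-error randomized and quantum query complexities of $f$: the least number $T$ such that some randomized (respectively quantum) algorithm that makes at most $T$ queries to the entries of $x$ outputs $f(x)$ with error probability less than $1/3$ for every $x\in X$. There is an absolute constant $c>0$ such that for all integers $M\ge 2$ and $n\ge 0$, every symmetric $X\subseteq[M]^n$ and every symmetric $f:X\to\{0,1\}$, $$Q(f)\ \ge\ c\,\frac{R(f)^{1/8}}{M\,\log^{1/8}M}.$$ Equivalently, there is an absolute constant $C>0$ such that $R(f)\le C\,Q(f)^8\,M^8\log M$ for all such $M,n,X,f$ (and this second inequality also holds for $M=1$). -/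

import Mathlib

namespace QueryComplexity

/-- An input of length `n` over the alphabet `[M] = {0, …, M - 1}`. -/
abbrev Input (n M : ℕ) : Type := Fin n → Fin M

/-- A promise is symmetric if it is invariant under permutations of the positions. -/
def IsSymmetricPromise {n M : ℕ} (X : Set (Input n M)) : Prop :=
  ∀ x ∈ X, ∀ σ : Equiv.Perm (Fin n), x ∘ σ ∈ X

/-- A partial function is symmetric if its value does not change when the positions of the
input are permuted, i.e. if it depends only on the multiset of entries of the input. -/
def IsSymmetricFunction {n M : ℕ} {X : Set (Input n M)} (f : X → Bool) : Prop :=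
  ∀ (x y : X) (σ : Equiv.Perm (Fin n)), (y : Input n M) = (x : Input n M) ∘ σ → f y = f x

/-! ### Randomized query complexity -/

/-- Deterministic adaptive query algorithms with one-bit output. -/
inductive DecisionTree (n M : ℕ) : Type
  | leaf (b : Bool) : DecisionTree n M
  | query (i : Fin n) (next : Fin M → DecisionTree n M) : DecisionTree n M

namespace DecisionTree

/-- The output on the input `x`. -/
def eval {n M : ℕ} : DecisionTree n M → Input n M → Bool
  | leaf b, _ => b
  | query i next, x => (next (x i)).eval x

/-- The number of queries made on the input `x`. -/
def cost {n M : ℕ} : DecisionTree n M → Input n M → ℕ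
  | leaf _, _ => 0
  | query i next, x => (next (x i)).cost x + 1

end DecisionTree

/-- The randomized algorithm `p`, a probability distribution on deterministic query algorithms,
makes at most `T` queries on every input of the promise, whatever its coin tosses, and errs
with probability less than `1 / 3` on each of them. -/
def RandomizedComputes {n M : ℕ} {X : Set (Input n M)} (p : PMF (DecisionTree n M)) (T : ℕ)
    (f : X → Bool) : Prop :=
  ∀ x : X, (∀ t ∈ p.support, t.cost x ≤ T) ∧ p.toOuterMeasure {t | t.eval x ≠ f x} < 1 / 3

/-- The bounded-error randomized query complexity `R(f)`. -/
noncomputable def R {n M : ℕ} {X : Set (Input n M)} (f : X → Bool) : ℕ :=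
  sInf {T : ℕ | ∃ p : PMF (DecisionTree n M), RandomizedComputes p T f}

/-! ### Quantum query complexity -/

/-- Labels `(i, b, w)` of the computational basis: a query register, which holds a position or
`none` (no position is queried), an answer register, and a workspace. -/
abbrev Basis (n M : ℕ) (W : Type) : Type := Option (Fin n) × Fin M × W

/-- The oracle `|i, b, w⟩ ↦ |i, b + x i mod M, w⟩`, `|none, b, w⟩ ↦ |none, b, w⟩`,
acting on amplitude vectors. -/
def oracle {n M : ℕ} {W : Type} (x : Input n M) (ψ : Basis n M W → ℂ) : Basis n M W → ℂ
  | (some i, b, w) => ψ (some i, b - x i, w)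
  | (none, b, w) => ψ (none, b, w)

/-- A quantum query algorithm: a finite workspace, an initial basis state, input-independent
unitaries `unitary 0, unitary 1, …` applied before, between and after the queries, and the output
bit read off from a final measurement in the computational basis. -/
structure QuantumAlgorithm (n M : ℕ) where
  Work : Type
  [fintypeWork : Fintype Work]
  [decEqWork : DecidableEq Work]
  start : Basis n M Work
  unitary : ℕ → Matrix.unitaryGroup (Basis n M Work) ℂ
  out : Basis n M Work → Bool

attribute [instance] QuantumAlgorithm.fintypeWork QuantumAlgorithm.decEqWork

namespace QuantumAlgorithm

/-- The state after `T` queries, `U_T O_x U_{T-1} ⋯ O_x U_0 |start⟩`. -/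
def state {n M : ℕ} (A : QuantumAlgorithm n M) (x : Input n M) : ℕ → Basis n M A.Work → ℂ
  | 0 => (A.unitary 0).1.mulVec (Pi.single A.start 1)
  | T + 1 => (A.unitary (T + 1)).1.mulVec (oracle x (A.state x T))

/-- The probability that the algorithm, stopped after `T` queries, outputs `b`. -/
noncomputable def prob {n M : ℕ} (A : QuantumAlgorithm n M) (x : Input n M) (T : ℕ)
    (b : Bool) : ℝ :=
  ∑ z : Basis n M A.Work, if A.out z = b then ‖A.state x T z‖ ^ 2 else 0

end QuantumAlgorithm

/-- `A` with `T` queries errs with probability less than `1 / 3` on every input of the promise. -/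
def QuantumComputes {n M : ℕ} {X : Set (Input n M)} (A : QuantumAlgorithm n M) (T : ℕ)
    (f : X → Bool) : Prop :=
  ∀ x : X, A.prob x T (!f x) < 1 / 3

/-- The bounded-error quantum query complexity `Q(f)`. -/
noncomputable def Q {n M : ℕ} {X : Set (Input n M)} (f : X → Bool) : ℕ :=
  sInf {T : ℕ | ∃ A : QuantumAlgorithm n M, QuantumComputes A T f}

/-! ### Both infima are over nonempty sets -/

/-- Reading the whole input is a randomized algorithm with `n` queries. -/
theorem exists_randomizedComputes {n M : ℕ} {X : Set (Input n M)} (f : X → Bool) :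
    ∃ p : PMF (DecisionTree n M), RandomizedComputes p n f := by
  classical
  have key : ∀ (k : ℕ), k ≤ n → ∀ g : Input n M → Bool,
      (∀ x y : Input n M, (∀ i : Fin n, i.1 < k → x i = y i) → g x = g y) →
      ∃ t : DecisionTree n M, ∀ x, t.eval x = g x ∧ t.cost x ≤ k := by
    intro k
    induction k with
    | zero =>
      intro _ g hg
      by_cases hne : Nonempty (Input n M)
      · obtain ⟨y⟩ := hne
        exact ⟨.leaf (g y), fun x => ⟨hg y x (by simp), le_rfl⟩⟩
      · exact ⟨.leaf false, fun x => (hne ⟨x⟩).elim⟩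
    | succ k ih =>
      intro hk g hg
      have h : ∀ a : Fin M, ∃ t : DecisionTree n M, ∀ x,
          t.eval x = g (Function.update x ⟨k, hk⟩ a) ∧ t.cost x ≤ k := by
        intro a
        refine ih (by omega) (fun x => g (Function.update x ⟨k, hk⟩ a)) ?_
        intro x y hxy
        apply hg
        intro i hi
        by_cases h : i = ⟨k, hk⟩
        · subst h; simp
        · have : i.1 ≠ k := fun h' => h (Fin.ext h')
          simp [Function.update_of_ne h, hxy i (by omega)]
      choose t ht using h
      refine ⟨.query ⟨k, hk⟩ t, fun x => ⟨?_, ?_⟩⟩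
      · simp [DecisionTree.eval, (ht _ x).1]
      · simpa [DecisionTree.cost] using (ht (x ⟨k, hk⟩) x).2
  obtain ⟨t, ht⟩ := key n le_rfl (fun x => if h : x ∈ X then f ⟨x, h⟩ else false)
    (fun x y h => by rw [funext fun i => h i i.2])
  refine ⟨PMF.pure t, fun x => ⟨?_, ?_⟩⟩
  · intro t' h
    rw [PMF.support_pure, Set.mem_singleton_iff] at h
    exact h ▸ (ht x).2
  · rw [PMF.toOuterMeasure_pure_apply, if_neg]
    · simp
    · simp [(ht x).1]

/-- Reading the whole input is a quantum algorithm with `n` queries. -/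
theorem exists_quantumComputes {n M : ℕ} (hM : 1 ≤ M) {X : Set (Input n M)} (f : X → Bool) :
    ∃ A : QuantumAlgorithm n M, QuantumComputes A n f := by
  classical
  have : NeZero M := ⟨by omega⟩
  let B := Basis n M (Input n M)
  let idx : ℕ → Option (Fin n) := fun k => if h : k < n then some ⟨k, h⟩ else none
  let store : B → B := fun z => match z with
    | (some i, b, w) => (some i, w i, Function.update w i b)
    | (none, b, w) => (none, b, w)
  have hstore : Function.Involutive store := by
    rintro ⟨_ | i, b, w⟩ <;> simp [store]
  let step : ℕ → Equiv.Perm B := fun k => (hstore.toPerm store).trans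
    (Equiv.prodCongr (Equiv.swap (idx k) (idx (k + 1))) (Equiv.refl _))
  let P : Equiv.Perm B → Matrix.unitaryGroup B ℂ := fun σ =>
    ⟨(σ⁻¹).permMatrix ℂ, by
      rw [Matrix.mem_unitaryGroup_iff, Matrix.star_eq_conjTranspose,
        Matrix.conjTranspose_permMatrix, ← Matrix.permMatrix_mul]
      simp⟩
  have hP : ∀ (σ : Equiv.Perm B) (z : B),
      (P σ).1.mulVec (Pi.single z 1) = Pi.single (σ z) (1 : ℂ) := by
    intro σ z
    show ((σ⁻¹).permMatrix ℂ).mulVec _ = _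
    rw [Matrix.permMatrix_mulVec]
    ext y
    simp only [Function.comp, Pi.single_apply]
    congr 1
    rw [Equiv.Perm.inv_eq_iff_eq, eq_iff_iff]
  let A : QuantumAlgorithm n M :=
    { Work := Input n M
      start := (idx 0, 0, 0)
      unitary := fun k => match k with
        | 0 => P 1
        | k + 1 => P (step k)
      out := fun z => if h : z.2.2 ∈ X then f ⟨z.2.2, h⟩ else false }
  have hst : ∀ x : Input n M, ∀ k ≤ n,
      A.state x k = Pi.single (idx k, 0, fun i => if i.1 < k then x i else 0) (1 : ℂ) := by
    intro x k
    induction k with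
    | zero =>
      intro _
      exact hP 1 _
    | succ k ih =>
      intro hk
      have hidx : idx k = some ⟨k, hk⟩ := by simp only [idx]; rw [dif_pos]
      have ho : oracle x (A.state x k) =
          Pi.single ((idx k, x ⟨k, hk⟩, fun i => if i.1 < k then x i else 0) : B) (1 : ℂ) := by
        rw [ih (by omega), hidx]
        funext z
        obtain ⟨_ | i, b, w⟩ := z
        · simp [oracle]
        · simp only [oracle, Pi.single_apply, Prod.mk.injEq, Option.some.injEq]
          congr 1
          rw [eq_iff_iff]
          constructor
          · rintro ⟨rfl, h, h'⟩
            exact ⟨rfl, sub_eq_zero.1 h, h'⟩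
          · rintro ⟨rfl, h, h'⟩
            exact ⟨rfl, sub_eq_zero.2 h, h'⟩
      show (P (step k)).1.mulVec (oracle x (A.state x k)) = _
      rw [ho, hP]
      congr 1
      have h1 : store (idx k, x ⟨k, hk⟩, fun i => if i.1 < k then x i else 0) =
          (idx k, 0, fun i => if i.1 < k + 1 then x i else 0) := by
        rw [hidx]
        simp only [store, lt_irrefl, if_false]
        refine congrArg (fun w => (some _, 0, w)) (funext fun i => ?_)
        by_cases h : i = ⟨k, hk⟩
        · subst h; simp
        · have h' : i.1 ≠ k := fun h' => h (Fin.ext h')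
          rw [Function.update_of_ne h]
          have : i.1 < k ↔ i.1 < k + 1 := by omega
          simp [this]
      show Prod.map _ _ (store _) = _
      rw [h1]
      simp [Prod.map]
  refine ⟨A, fun x => ?_⟩
  have : A.prob x n (!f x) = 0 := by
    unfold QuantumAlgorithm.prob
    refine Finset.sum_eq_zero fun z _ => ?_
    split_ifs with h
    · rw [hst x n le_rfl]
      have hz : z ≠ (idx n, 0, fun i => if i.1 < n then x.1 i else 0) := by
        rintro rfl
        simp [A] at h
      rw [Pi.single_eq_of_ne hz]
      simp
    · rfl
  rw [this]
  norm_num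

end QueryComplexity

/-! ### Markov's inequality and interpolation at integer points -/

namespace QueryComplexity

open Polynomial

/-! The proof is the polynomial method, and it yields the stronger bound `R f = O(M ^ 4 * Q f ^ 4)`.
The acceptance probability of a `q`-query algorithm is a function of degree at most `2 * q`.
Averaging it over permutations of the input gives a function `F` of the type alone, with values in
`[0, 1]` on all of `[M]^n`, even off the promise.

Fix letters `a ≠ b` and the set `S` of positions holding one of them. As a function of the number of
`a`'s in `S`, `F` is a polynomial of degree at most `d = 2 * q`, bounded at `0, …, |S|`. By Markov's
inequality it has Lipschitz constant `O(d ^ 2 / |S|)`, so turning one entry into a frequent letter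
`b` moves `F` very little (`abs_update_sub_le`). Two inputs with close types share a letter of
frequency about `1 / M`; aligned by a permutation, they become equal once that letter is written on
their few disagreements (`abs_sub_le_of_letterCount`).

Hence types within `O(1 / (M ^ 2 * q ^ 2))` in every frequency have values of `F` within `1 / 3`,
and `f` agrees on them (`eq_of_letterCount_close`). Estimating the frequencies from `O(M ^ 4 * q ^
4)` random samples then determines `f` (`R_le_of_separated`). Inputs too short for the Markov step
are read entirely. -/

/-- Markov's inequality at the right end point of `[0, x]`. -/
theorem eval_derivative_le_at_right {d : ℕ} {p : ℝ[X]} (hp : p.natDegree ≤ d) {B x : ℝ}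
    (hB : 0 < B) (hx : 0 < x) (hb : ∀ t ∈ Set.Icc 0 x, |p.eval t| ≤ B) :
    (derivative p).eval x ≤ 2 * d ^ 2 * B / x := by
  -- Rescaling turns `[0, x]` into `[-1, 1]` and the bound `B` into `1`. There the derivative at `1`
  -- is at most that of the Chebyshev polynomial of degree `d`, namely `d ^ 2`; the chain rule
  -- contributes `2 / x`.
  set P : ℝ[X] := C B⁻¹ * p.comp (C (x / 2) * (X + 1)) with hP
  have hlin : (C (x / 2) * (X + 1) : ℝ[X]).natDegree ≤ 1 := by compute_degree
  have hdeg : P.degree ≤ d := by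
    refine natDegree_le_iff_degree_le.1 ?_
    refine (natDegree_C_mul_le _ _).trans ?_
    refine natDegree_comp_le.trans ?_
    calc p.natDegree * _ ≤ d * 1 := Nat.mul_le_mul hp hlin
      _ = d := mul_one d
  have hbnd : ∀ u ∈ Set.Icc (-1 : ℝ) 1, |P.eval u| ≤ 1 := by
    intro u hu
    have : |p.eval (x / 2 * (u + 1))| ≤ B := by
      apply hb
      constructor
      · have := hu.1
        have : 0 ≤ u + 1 := by linarith
        positivity
      · nlinarith [hu.2]
    simp only [hP, eval_mul, eval_C, eval_comp, eval_add, eval_X, eval_one, abs_mul, abs_inv,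
      abs_of_pos hB]
    rw [inv_mul_le_iff₀ hB]
    simpa using this
  have key := Chebyshev.eval_iterate_derivative_le_of_forall_abs_le_one (k := 1) (le_refl (1 : ℝ))
    hdeg hbnd
  simp only [Function.iterate_one, Chebyshev.derivative_T_eval_one] at key
  have hder : (derivative P).eval 1 = B⁻¹ * (x / 2) * (derivative p).eval x := by
    simp [hP, derivative_comp]
    ring_nf
  rw [hder] at key
  rw [le_div_iff₀ hx]
  have : (derivative p).eval x * x = 2 * B * (B⁻¹ * (x / 2) * (derivative p).eval x) := by
    field_simp
  rw [this]
  push_cast at key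
  nlinarith

/-- A form of Markov's inequality on `[0, L]`. -/
theorem abs_eval_derivative_le {d : ℕ} {p : ℝ[X]} (hp : p.natDegree ≤ d) {B L : ℝ}
    (hB : 0 < B) (hL : 0 < L) (hb : ∀ t ∈ Set.Icc 0 L, |p.eval t| ≤ B) {x : ℝ}
    (hx : x ∈ Set.Icc 0 L) :
    |(derivative p).eval x| ≤ 4 * d ^ 2 * B / L := by
  -- In the right half, `x` serves as the right end point of `[0, x]`, which at most doubles the
  -- bound since `L / x ≤ 2`. The left half follows by the reflection `t ↦ L - t`.
  have half : ∀ q : ℝ[X], q.natDegree ≤ d → (∀ t ∈ Set.Icc 0 L, |q.eval t| ≤ B) →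
      ∀ x ∈ Set.Icc 0 L, L / 2 ≤ x → |(derivative q).eval x| ≤ 4 * d ^ 2 * B / L := by
    intro q hq hqb x hx hxL
    have hx0 : 0 < x := by linarith
    have hle : 2 * d ^ 2 * B / x ≤ 4 * d ^ 2 * B / L := by
      rw [div_le_div_iff₀ hx0 hL]
      have : 0 ≤ d ^ 2 * B := by positivity
      nlinarith
    refine abs_le.2 ⟨?_, ?_⟩
    · have := eval_derivative_le_at_right (p := -q) (by simpa using hq) hB hx0
        (fun t ht => by simpa using hqb t ⟨ht.1, ht.2.trans hx.2⟩)
      simp only [derivative_neg, eval_neg] at this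
      linarith
    · exact (eval_derivative_le_at_right hq hB hx0
        (fun t ht => hqb t ⟨ht.1, ht.2.trans hx.2⟩)).trans hle
  rcases le_total (L / 2) x with h | h
  · exact half p hp hb x hx h
  · have hlin : (C L - X : ℝ[X]).natDegree ≤ 1 := by compute_degree
    have := half (p.comp (C L - X))
      (natDegree_comp_le.trans ((Nat.mul_le_mul hp hlin).trans_eq (mul_one d)))
      (fun t ht => by
        rw [eval_comp]
        apply hb
        simp only [eval_sub, eval_C, eval_X]
        exact ⟨by linarith [ht.2], by linarith [ht.1]⟩)
      (L - x) ⟨by linarith [hx.2], by linarith [hx.1]⟩ (by linarith)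
    simpa [derivative_comp] using this

theorem abs_eval_sub_eval_le {d : ℕ} {p : ℝ[X]} (hp : p.natDegree ≤ d) {B L : ℝ}
    (hB : 0 < B) (hL : 0 < L) (hb : ∀ t ∈ Set.Icc 0 L, |p.eval t| ≤ B) {x y : ℝ}
    (hx : x ∈ Set.Icc 0 L) (hy : y ∈ Set.Icc 0 L) :
    |p.eval y - p.eval x| ≤ 4 * d ^ 2 * B / L * |y - x| := by
  have := (convex_Icc 0 L).norm_image_sub_le_of_norm_deriv_le (f := fun t => p.eval t)
    (C := 4 * d ^ 2 * B / L) (fun t _ => p.differentiableAt)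
    (fun t ht => by
      rw [Polynomial.deriv]
      exact abs_eval_derivative_le hp hB hL hb ht) hx hy
  simpa [Real.norm_eq_abs] using this

/-- A polynomial that is bounded by `1` at the integers `0, …, L` is Lipschitz on `[0, L]`,
provided that `L` is large compared with the square of its degree. -/
theorem abs_eval_sub_eval_le_of_nat {d L : ℕ} {p : ℝ[X]} (hp : p.natDegree ≤ d)
    (hL0 : 0 < L) (hL : 8 * d ^ 2 ≤ L) (hb : ∀ i : ℕ, i ≤ L → |p.eval (i : ℝ)| ≤ 1) {x y : ℝ}
    (hx : x ∈ Set.Icc (0 : ℝ) L) (hy : y ∈ Set.Icc (0 : ℝ) L) :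
    |p.eval y - p.eval x| ≤ 8 * d ^ 2 / L * |y - x| := by
  have hL0' : (0 : ℝ) < L := by exact_mod_cast hL0
  have hL' : (8 : ℝ) * d ^ 2 ≤ L := by exact_mod_cast hL
  obtain ⟨s, hs, hmax⟩ := isCompact_Icc.exists_isMaxOn (Set.nonempty_Icc.2 hL0'.le)
    (f := fun t => |p.eval t|) (p.continuous.abs.continuousOn)
  set B := |p.eval s| with hBdef
  have hbB : ∀ t ∈ Set.Icc (0 : ℝ) L, |p.eval t| ≤ max B 1 := fun t ht =>
    (hmax ht).trans (le_max_left _ _)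
  have hBpos : 0 < max B 1 := lt_max_of_lt_right one_pos
  -- The bound improves itself: the derivative is at most half of `max B 1`, and the maximum is
  -- attained within distance `1` of an integer, so `1 ≤ B` forces `B ≤ 1 + B / 2`.
  have hB2 : max B 1 ≤ 2 := by
    rcases le_total B 1 with h | h
    · rw [max_eq_right h]; norm_num
    · have hi : ⌊s⌋₊ ≤ L := Nat.floor_le_of_le hs.2
      have h1 := abs_eval_sub_eval_le hp hBpos hL0' hbB
        (x := (⌊s⌋₊ : ℝ)) (y := s) ⟨by positivity, by exact_mod_cast hi⟩ hs
      have h2 : |s - ⌊s⌋₊| ≤ 1 := by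
        have := Nat.floor_le hs.1
        have := Nat.lt_floor_add_one s
        rw [abs_le]; constructor <;> linarith
      have h3 : 4 * (d : ℝ) ^ 2 * max B 1 / L ≤ max B 1 / 2 := by
        rw [div_le_div_iff₀ hL0' two_pos]
        nlinarith
      have h4 : |p.eval s| ≤ |p.eval (⌊s⌋₊ : ℝ)| + |p.eval s - p.eval (⌊s⌋₊ : ℝ)| := by
        have := abs_add_le (p.eval (⌊s⌋₊ : ℝ)) (p.eval s - p.eval (⌊s⌋₊ : ℝ))
        simpa using this
      have h5 : 4 * (d : ℝ) ^ 2 * max B 1 / L * |s - ⌊s⌋₊| ≤ max B 1 / 2 * 1 := by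
        gcongr
      have h6 := hb _ hi
      rw [max_eq_left h] at *
      linarith
  have := abs_eval_sub_eval_le hp hBpos hL0' hbB hx hy
  refine this.trans (mul_le_mul_of_nonneg_right ?_ (abs_nonneg _))
  rw [div_le_div_iff_of_pos_right hL0']
  nlinarith [sq_nonneg (d : ℝ)]

/-- If all forward differences at `0` of order between `d + 1` and `L` vanish, then `h` agrees on
`0, …, L` with a polynomial of degree at most `d`. -/
theorem exists_polynomial_of_fwdDiff_eq_zero (h : ℕ → ℝ) (d L : ℕ)
    (hh : ∀ k, d < k → k ≤ L → (fwdDiff 1)^[k] h 0 = 0) :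
    ∃ p : ℝ[X], p.natDegree ≤ d ∧ ∀ t : ℕ, t ≤ L → p.eval (t : ℝ) = h t := by
  -- Newton's forward difference formula, truncated after order `d`.
  refine ⟨∑ k ∈ Finset.range (d + 1),
    C ((fwdDiff 1)^[k] h 0 / (k.factorial : ℝ)) * descPochhammer ℝ k, ?_, ?_⟩
  · refine natDegree_sum_le_of_forall_le _ _ fun k hk => ?_
    refine (natDegree_C_mul_le _ _).trans ?_
    rw [descPochhammer_natDegree]
    exact Nat.lt_succ_iff.1 (Finset.mem_range.1 hk)
  · intro t ht
    have newton := shift_eq_sum_fwdDiff_iter 1 h t 0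
    simp only [smul_eq_mul, mul_one, zero_add] at newton
    rw [newton, eval_finsetSum]
    have hterm : ∀ k, (C ((fwdDiff 1)^[k] h 0 / (k.factorial : ℝ)) * descPochhammer ℝ k).eval
        (t : ℝ) = t.choose k • (fwdDiff 1)^[k] h 0 := by
      intro k
      rw [eval_mul, eval_C, nsmul_eq_mul, Nat.cast_choose_eq_descPochhammer_div]
      ring
    simp only [hterm]
    have hz : ∀ k, k ≤ t → d < k → t.choose k • (fwdDiff 1)^[k] h 0 = 0 := fun k hk hd => by
      rw [hh k hd (hk.trans ht), smul_zero]
    have hz' : ∀ k, t < k → t.choose k • (fwdDiff 1)^[k] h 0 = 0 := fun k hk => by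
      rw [Nat.choose_eq_zero_of_lt hk, zero_smul]
    rcases le_total d t with hdt | hdt
    · refine Finset.sum_subset (Finset.range_subset_range.2 (by omega)) fun k hk hk' => ?_
      simp only [Finset.mem_range] at hk hk'
      exact hz k (by omega) (by omega)
    · refine (Finset.sum_subset (Finset.range_subset_range.2 (by omega)) fun k hk hk' => ?_).symm
      simp only [Finset.mem_range] at hk hk'
      exact hz' k (by omega)

end QueryComplexity

/-! ### Functions of bounded degree on inputs -/

namespace QueryComplexity

/-- The functions of degree at most `d` in the input: linear combinations of functions each of
which depends on at most `d` positions. -/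
def degreeLE (n M d : ℕ) : Submodule ℂ (Input n M → ℂ) :=
  Submodule.span ℂ {g | ∃ U : Finset (Fin n), U.card ≤ d ∧ DependsOn g (U : Set (Fin n))}

section degree

variable {n M d e : ℕ}

theorem degreeLE_of_dependsOn {g : Input n M → ℂ} {U : Finset (Fin n)} (hU : U.card ≤ d)
    (hg : DependsOn g (U : Set (Fin n))) : g ∈ degreeLE n M d :=
  Submodule.subset_span ⟨U, hU, hg⟩

theorem const_mem_degreeLE (c : ℂ) : (fun _ => c) ∈ degreeLE n M d :=
  degreeLE_of_dependsOn (U := ∅) (by simp) fun _ _ _ => rfl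

theorem mul_mem_degreeLE {f g : Input n M → ℂ} (hf : f ∈ degreeLE n M d)
    (hg : g ∈ degreeLE n M e) : f * g ∈ degreeLE n M (d + e) := by
  classical
  induction hf, hg using Submodule.span_induction₂ with
  | mem_mem f g hf hg =>
    obtain ⟨U, hU, hfU⟩ := hf
    obtain ⟨V, hV, hgV⟩ := hg
    refine degreeLE_of_dependsOn (U := U ∪ V) ((Finset.card_union_le _ _).trans (by omega)) ?_
    intro x y hxy
    simp only [Pi.mul_apply]
    rw [hfU fun i hi => hxy i (by simpa using Or.inl hi),
      hgV fun i hi => hxy i (by simpa using Or.inr hi)]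
  | zero_left => simp
  | zero_right => simp
  | add_left _ _ _ _ _ _ h h' => rw [add_mul]; exact add_mem h h'
  | add_right _ _ _ _ _ _ h h' => rw [mul_add]; exact add_mem h h'
  | smul_left r _ _ _ _ h => rw [smul_mul_assoc]; exact Submodule.smul_mem _ r h
  | smul_right r _ _ _ _ h => rw [mul_smul_comm]; exact Submodule.smul_mem _ r h

theorem star_mem_degreeLE {f : Input n M → ℂ} (hf : f ∈ degreeLE n M d) :
    star f ∈ degreeLE n M d := by
  induction hf using Submodule.span_induction with
  | mem f hf =>
    obtain ⟨U, hU, hfU⟩ := hf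
    exact degreeLE_of_dependsOn hU fun x y hxy => congrArg star (hfU hxy)
  | zero => simp
  | add _ _ _ _ h h' => rw [star_add]; exact add_mem h h'
  | smul r _ _ h => rw [star_smul]; exact Submodule.smul_mem _ _ h

theorem comp_perm_mem_degreeLE {f : Input n M → ℂ} (hf : f ∈ degreeLE n M d)
    (σ : Equiv.Perm (Fin n)) : (fun x : Input n M => f (x ∘ σ)) ∈ degreeLE n M d := by
  induction hf using Submodule.span_induction with
  | mem f hf =>
    obtain ⟨U, hU, hfU⟩ := hf
    refine degreeLE_of_dependsOn (U := U.map σ.toEmbedding) (by simpa using hU) ?_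
    intro x y hxy
    refine hfU fun i hi => hxy (σ i) ?_
    simpa using hi
  | zero => exact zero_mem _
  | add _ _ _ _ h h' => exact add_mem h h'
  | smul r _ _ h => exact Submodule.smul_mem _ r h

/-- A generator ignores some `w ∈ W`, so the terms of `V` and `insert w V` cancel. -/
theorem sum_powerset_eq_zero_of_mem_degreeLE {f : Input n M → ℂ} (hf : f ∈ degreeLE n M d)
    {W : Finset (Fin n)} (hW : d < W.card) (u v : Input n M) :
    ∑ V ∈ W.powerset, (-1 : ℂ) ^ V.card * f (V.piecewise u v) = 0 := by
  classical
  induction hf using Submodule.span_induction with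
  | mem f hf =>
    obtain ⟨U, hU, hfU⟩ := hf
    obtain ⟨w, hwW, hwU⟩ := Finset.exists_mem_notMem_of_card_lt_card (hU.trans_lt hW)
    rw [← Finset.insert_erase hwW, Finset.sum_powerset_insert (Finset.notMem_erase w W),
      ← Finset.sum_add_distrib]
    refine Finset.sum_eq_zero fun V hV => ?_
    have hwV : w ∉ V := fun h => Finset.notMem_erase w W (Finset.mem_powerset.1 hV h)
    have : f ((insert w V).piecewise u v) = f (V.piecewise u v) := by
      refine hfU fun i hi => ?_
      have hiw : i ≠ w := fun h => hwU (by simpa [h] using hi)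
      exact Finset.piecewise_insert_of_ne _ _ _ hiw
    rw [this, Finset.card_insert_of_notMem hwV, pow_succ]
    ring
  | zero => simp
  | add _ _ _ _ h h' =>
    simp only [Pi.add_apply, mul_add, Finset.sum_add_distrib, h, h', add_zero]
  | smul r _ _ h =>
    simp only [Pi.smul_apply, smul_eq_mul, mul_left_comm _ r, ← Finset.mul_sum, h, mul_zero]

end degree

/-! ### Acceptance probabilities as bounded functions of low degree -/

namespace QuantumAlgorithm

variable {n M : ℕ}

/-- A queried amplitude is a sum over letters `c` of an old amplitude times the indicator of `x i =
c`, which depends on one position. -/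
theorem oracle_mem_degreeLE {W : Type} {d : ℕ} {ψ : Input n M → Basis n M W → ℂ}
    (hψ : ∀ z, (fun x => ψ x z) ∈ degreeLE n M d) (z : Basis n M W) :
    (fun x => oracle x (ψ x) z) ∈ degreeLE n M (d + 1) := by
  classical
  obtain ⟨_ | i, b, w⟩ := z
  · have := mul_mem_degreeLE (hψ (none, b, w)) (const_mem_degreeLE (d := 1) 1)
    convert this using 1
    funext x
    simp [oracle]
  · have : (fun x => oracle x (ψ x) (some i, b, w)) =
        ∑ c : Fin M, (fun x => ψ x (some i, b - c, w)) *
          (fun x : Input n M => if x i = c then (1 : ℂ) else 0) := by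
      funext x
      simp [oracle, Finset.sum_apply]
    rw [this]
    refine Submodule.sum_mem _ fun c _ => mul_mem_degreeLE (hψ _) ?_
    refine degreeLE_of_dependsOn (U := {i}) (by simp) fun x y hxy => ?_
    simp only [hxy i (by simp)]

theorem mulVec_mem_degreeLE {B : Type} [Fintype B] {d : ℕ} {ψ : Input n M → B → ℂ}
    (hψ : ∀ z, (fun x => ψ x z) ∈ degreeLE n M d) (U : Matrix B B ℂ) (z : B) :
    (fun x => U.mulVec (ψ x) z) ∈ degreeLE n M d := by
  have : (fun x => U.mulVec (ψ x) z) = ∑ y, U z y • (fun x => ψ x y) := by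
    funext x
    simp [Matrix.mulVec, dotProduct, Finset.sum_apply]
  rw [this]
  exact Submodule.sum_mem _ fun y _ => Submodule.smul_mem _ _ (hψ y)

/-- The amplitudes after `T` queries have degree at most `T`. -/
theorem state_mem_degreeLE (A : QuantumAlgorithm n M) (T : ℕ) (z : Basis n M A.Work) :
    (fun x => A.state x T z) ∈ degreeLE n M T := by
  induction T generalizing z with
  | zero => exact const_mem_degreeLE _
  | succ T ih => exact mulVec_mem_degreeLE (oracle_mem_degreeLE ih) _ z

/-- The output probabilities after `T` queries have degree at most `2 * T`. -/
theorem prob_mem_degreeLE (A : QuantumAlgorithm n M) (T : ℕ) (b : Bool) :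
    (fun x => (A.prob x T b : ℂ)) ∈ degreeLE n M (2 * T) := by
  have : (fun x => (A.prob x T b : ℂ)) =
      ∑ z : Basis n M A.Work, (if A.out z = b then (1 : ℂ) else 0) •
        ((fun x => A.state x T z) * star (fun x => A.state x T z)) := by
    funext x
    simp only [prob, Complex.ofReal_sum, Finset.sum_apply]
    refine Finset.sum_congr rfl fun z _ => ?_
    split_ifs
    · simp [Complex.mul_conj']
    · simp
  rw [this]
  refine Submodule.sum_mem _ fun z _ => Submodule.smul_mem _ _ ?_
  rw [two_mul]
  exact mul_mem_degreeLE (A.state_mem_degreeLE T z) (star_mem_degreeLE (A.state_mem_degreeLE T z))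

theorem sum_norm_sq_mulVec {B : Type} [Fintype B] [DecidableEq B]
    (U : Matrix.unitaryGroup B ℂ) (ψ : B → ℂ) :
    ∑ z, ‖U.1.mulVec ψ z‖ ^ 2 = ∑ z, ‖ψ z‖ ^ 2 := by
  have key : ∀ φ : B → ℂ, ((∑ z, ‖φ z‖ ^ 2 : ℝ) : ℂ) = star φ ⬝ᵥ φ := by
    intro φ
    simp [dotProduct, Complex.conj_mul']
  apply Complex.ofReal_injective
  rw [key, key, Matrix.star_mulVec, Matrix.dotProduct_mulVec, Matrix.vecMul_vecMul,
    ← Matrix.star_eq_conjTranspose, (Matrix.mem_unitaryGroup_iff'.1 U.2), Matrix.vecMul_one]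

theorem sum_norm_sq_oracle {W : Type} [Fintype W] (hM : 1 ≤ M) (x : Input n M)
    (ψ : Basis n M W → ℂ) : ∑ z, ‖oracle x ψ z‖ ^ 2 = ∑ z, ‖ψ z‖ ^ 2 := by
  have : NeZero M := ⟨by omega⟩
  simp only [Fintype.sum_prod_type, Fintype.sum_option, oracle]
  congr 1
  refine Finset.sum_congr rfl fun i _ => ?_
  exact (Equiv.subRight (x i)).sum_comp fun b => ∑ w, ‖ψ (some i, b, w)‖ ^ 2

theorem sum_norm_sq_state (hM : 1 ≤ M) (A : QuantumAlgorithm n M) (x : Input n M) (T : ℕ) :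
    ∑ z, ‖A.state x T z‖ ^ 2 = 1 := by
  induction T with
  | zero =>
    rw [state, sum_norm_sq_mulVec, Finset.sum_eq_single A.start] <;> simp +contextual
  | succ T ih => rw [state, sum_norm_sq_mulVec, sum_norm_sq_oracle hM, ih]

theorem prob_nonneg (A : QuantumAlgorithm n M) (x : Input n M) (T : ℕ) (b : Bool) :
    0 ≤ A.prob x T b :=
  Finset.sum_nonneg fun z _ => by split_ifs <;> positivity

theorem prob_true_add_prob_false (hM : 1 ≤ M) (A : QuantumAlgorithm n M) (x : Input n M)
    (T : ℕ) : A.prob x T true + A.prob x T false = 1 := by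
  rw [prob, prob, ← Finset.sum_add_distrib, ← A.sum_norm_sq_state hM x T]
  refine Finset.sum_congr rfl fun z _ => ?_
  cases A.out z <;> simp

/-- The probability that `A` accepts a random permutation of the input. -/
noncomputable def symmProb (A : QuantumAlgorithm n M) (T : ℕ) (x : Input n M) : ℝ :=
  (∑ σ : Equiv.Perm (Fin n), A.prob (x ∘ σ) T true) / (n.factorial : ℝ)

theorem symmProb_comp_perm (A : QuantumAlgorithm n M) (T : ℕ) (x : Input n M)
    (τ : Equiv.Perm (Fin n)) : A.symmProb T (x ∘ τ) = A.symmProb T x := by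
  unfold symmProb
  congr 1
  exact Equiv.sum_comp (Equiv.mulLeft τ) fun σ : Equiv.Perm (Fin n) => A.prob (x ∘ σ) T true

theorem symmProb_mem_degreeLE (A : QuantumAlgorithm n M) (T : ℕ) :
    (fun x => (A.symmProb T x : ℂ)) ∈ degreeLE n M (2 * T) := by
  have : (fun x => (A.symmProb T x : ℂ)) = ((n.factorial : ℂ)⁻¹) •
      ∑ σ : Equiv.Perm (Fin n), fun x : Input n M => (A.prob (x ∘ σ) T true : ℂ) := by
    funext x
    simp [symmProb, Finset.sum_apply, div_eq_inv_mul]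
  rw [this]
  exact Submodule.smul_mem _ _ (Submodule.sum_mem _ fun σ _ =>
    comp_perm_mem_degreeLE (A.prob_mem_degreeLE T true) σ)

theorem symmProb_lt (A : QuantumAlgorithm n M) (T : ℕ) (x : Input n M) {c : ℝ}
    (h : ∀ σ : Equiv.Perm (Fin n), A.prob (x ∘ σ) T true < c) : A.symmProb T x < c := by
  rw [symmProb, div_lt_iff₀ (by positivity)]
  refine (Finset.sum_lt_sum_of_nonempty Finset.univ_nonempty fun σ _ => h σ).trans_eq ?_
  simp [Fintype.card_perm, mul_comm]

theorem lt_symmProb (A : QuantumAlgorithm n M) (T : ℕ) (x : Input n M) {c : ℝ}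
    (h : ∀ σ : Equiv.Perm (Fin n), c < A.prob (x ∘ σ) T true) : c < A.symmProb T x := by
  rw [symmProb, lt_div_iff₀ (by positivity)]
  refine (Finset.sum_lt_sum_of_nonempty Finset.univ_nonempty fun σ _ => h σ).trans_eq' ?_
  simp [Fintype.card_perm, mul_comm]

/-- Holding off the promise too, this bound allows interpolation through types that no element of
the promise has. -/
theorem abs_symmProb_le_one (hM : 1 ≤ M) (A : QuantumAlgorithm n M) (T : ℕ) (x : Input n M) :
    |A.symmProb T x| ≤ 1 := by
  have h0 : 0 ≤ A.symmProb T x :=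
    div_nonneg (Finset.sum_nonneg fun σ _ => A.prob_nonneg _ T true) (by positivity)
  rw [abs_of_nonneg h0, symmProb, div_le_one (by positivity)]
  refine (Finset.sum_le_card_nsmul _ _ 1 fun σ _ => ?_).trans_eq (by simp [Fintype.card_perm])
  linarith [A.prob_true_add_prob_false hM (x ∘ σ) T, A.prob_nonneg (x ∘ σ) T false]

end QuantumAlgorithm

end QueryComplexity

/-! ### Types, and the smoothness of symmetric functions of low degree -/

namespace QueryComplexity

variable {n M : ℕ}

/-- The number of occurrences of the letter `a` in `x`. -/
def letterCount (x : Input n M) (a : Fin M) : ℕ :=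
  (Finset.univ.filter fun i => x i = a).card

theorem letterCount_comp_perm (x : Input n M) (σ : Equiv.Perm (Fin n)) (a : Fin M) :
    letterCount (x ∘ σ) a = letterCount x a :=
  Finset.card_equiv σ fun i => by simp

theorem sum_letterCount (x : Input n M) : ∑ a, letterCount x a = n := by
  have := Finset.card_eq_sum_card_fiberwise (s := Finset.univ) (t := Finset.univ) (f := x)
    (fun _ _ => Finset.mem_coe.2 (Finset.mem_univ _))
  simpa [letterCount] using this.symm

/-- Two inputs can be aligned by a permutation so that they differ in no more positions than the
`ℓ¹`-distance of their types. -/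
theorem exists_perm_card_ne_le (x y : Input n M) : ∃ σ : Equiv.Perm (Fin n),
    ((Finset.univ.filter fun i => x i ≠ (y ∘ σ) i).card : ℝ) ≤
      ∑ a, |(letterCount x a : ℝ) - letterCount y a| := by
  -- The alignment with the fewest disagreements works.
  obtain ⟨σ, hσ⟩ := Finite.exists_min fun σ : Equiv.Perm (Fin n) =>
    (Finset.univ.filter fun i => x i ≠ (y ∘ σ) i).card
  refine ⟨σ, ?_⟩
  set z := y ∘ σ with hz
  set D := Finset.univ.filter fun i => x i ≠ z i with hD
  have hcount : ∀ a, ((D.filter fun i => x i = a).card : ℝ) - (D.filter fun i => z i = a).card =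
      letterCount x a - letterCount y a := by
    intro a
    rw [← letterCount_comp_perm y σ a, letterCount, letterCount,
      ← Finset.card_filter_add_card_filter_not (s := Finset.univ.filter fun i => x i = a)
        (fun i => x i = z i),
      ← Finset.card_filter_add_card_filter_not (s := Finset.univ.filter fun i => (y ∘ σ) i = a)
        (fun i => x i = z i)]
    have h1 : (Finset.univ.filter fun i => x i = a).filter (fun i => x i = z i) =
        (Finset.univ.filter fun i => (y ∘ σ) i = a).filter (fun i => x i = z i) := by
      ext i
      simp only [Finset.mem_filter, Finset.mem_univ, true_and, ← hz]
      constructor <;> rintro ⟨h, h'⟩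
      · exact ⟨h' ▸ h, h'⟩
      · exact ⟨h'.trans h, h'⟩
    have h2 : (Finset.univ.filter fun i => x i = a).filter (fun i => ¬ x i = z i) =
        D.filter fun i => x i = a := by
      ext i; simp [hD, and_comm]
    have h3 : (Finset.univ.filter fun i => (y ∘ σ) i = a).filter (fun i => ¬ x i = z i) =
        D.filter fun i => z i = a := by
      ext i; simp [hD, hz, and_comm]
    rw [h1, h2, h3]
    push_cast
    ring
  -- If `a` occurred in `D` both in `x`, at `i`, and in `z`, at `j`, swapping `i` and `j` would
  -- repair `i` and spoil nothing, as `j` is already wrong. So each letter is in surplus on one side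
  -- only, and its share of `D` is bounded by its difference of counts.
  have hdisj : ∀ a, (D.filter fun i => x i = a) = ∅ ∨ (D.filter fun i => z i = a) = ∅ := by
    intro a
    by_contra! hne
    obtain ⟨⟨i, hi⟩, ⟨j, hj⟩⟩ := hne
    rw [Finset.mem_filter] at hi hj
    have hlt : (Finset.univ.filter fun k => x k ≠ (y ∘ (σ * Equiv.swap i j : Equiv.Perm _)) k).card
        < D.card := by
      refine Finset.card_lt_card (Finset.ssubset_iff_of_subset ?_ |>.2 ⟨i, hi.1, ?_⟩)
      · intro k hk
        have hk := (Finset.mem_filter.1 hk).2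
        simp only [Function.comp_apply, Equiv.Perm.mul_apply] at hk
        by_cases hki : k = i
        · exact hki ▸ hi.1
        by_cases hkj : k = j
        · exact hkj ▸ hj.1
        rw [Equiv.swap_apply_of_ne_of_ne hki hkj] at hk
        simpa [hD, hz] using hk
      · have : y (σ j) = a := hj.2
        rw [Finset.mem_filter, not_and_not_right]
        intro _
        simp [hi.2, this]
    exact absurd (hσ (σ * Equiv.swap i j)) (not_le.2 hlt)
  have hfib : (D.card : ℝ) = ∑ a, ((D.filter fun i => x i = a).card : ℝ) := by
    rw [Finset.card_eq_sum_card_fiberwise (s := D) (t := Finset.univ) (f := x)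
      (fun _ _ => Finset.mem_coe.2 (Finset.mem_univ _))]
    push_cast
    rfl
  rw [hfib]
  refine Finset.sum_le_sum fun a _ => ?_
  rw [← hcount a]
  rcases hdisj a with h | h
  · rw [h]; simp
  · rw [h]; simp

theorem exists_perm_eq_of_letterCount_eq {x y : Input n M}
    (h : ∀ a, letterCount x a = letterCount y a) : ∃ σ : Equiv.Perm (Fin n), x = y ∘ σ := by
  obtain ⟨σ, hσ⟩ := exists_perm_card_ne_le x y
  refine ⟨σ, funext fun i => ?_⟩
  simp only [h, sub_self, abs_zero, Finset.sum_const_zero] at hσ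
  have h0 : (Finset.univ.filter fun i => x i ≠ (y ∘ σ) i).card = 0 := by
    exact_mod_cast le_antisymm hσ (by positivity)
  by_contra hne
  have : i ∈ Finset.univ.filter fun i => x i ≠ (y ∘ σ) i := by simpa using hne
  rw [Finset.card_eq_zero.1 h0] at this
  simp at this

/-- A symmetric function of degree at most `d`, bounded by `1`, changes little when one entry is
changed to a frequent letter. -/
theorem abs_update_sub_le {d : ℕ} {F : Input n M → ℝ}
    (hdeg : (fun x => (F x : ℂ)) ∈ degreeLE n M d)
    (hsymm : ∀ x (σ : Equiv.Perm (Fin n)), F (x ∘ σ) = F x) (hF : ∀ x, |F x| ≤ 1)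
    {L : ℕ} (hL0 : 0 < L) (hL : 8 * d ^ 2 ≤ L) (x : Input n M) (i : Fin n) {b : Fin M}
    (hb : L ≤ letterCount x b) :
    |F (Function.update x i b) - F x| ≤ 8 * d ^ 2 / L := by
  classical
  by_cases hab : x i = b
  · rw [← hab, Function.update_eq_self, sub_self, abs_zero]
    positivity
  set a := x i with ha
  -- For `V ⊆ S`, the input `y V` has `a` on `V`, `b` on the rest of `S`, and agrees with `x`
  -- elsewhere. Its type depends only on the size of `V`.
  set S := Finset.univ.filter fun j => x j = a ∨ x j = b with hS
  set v : Input n M := fun j => if x j = a then b else x j with hv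
  let y : Finset (Fin n) → Input n M := fun V => V.piecewise (fun _ => a) v
  have hva : ∀ j, v j ≠ a := by
    intro j
    simp only [hv]
    split_ifs with h
    · exact fun h' => hab h'.symm
    · exact h
  have hLS : L ≤ S.card := by
    refine hb.trans (Finset.card_le_card fun j => ?_)
    simp only [hS, Finset.mem_filter, Finset.mem_univ, true_and]
    exact Or.inr
  have hca : ∀ V, letterCount (y V) a = V.card := by
    intro V
    rw [letterCount]
    congr 1
    ext j
    by_cases hj : j ∈ V <;> simp [y, hj, hva]
  have hcb : ∀ V ⊆ S, letterCount (y V) b = S.card - V.card := by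
    intro V hV
    rw [letterCount, ← Finset.card_sdiff_of_subset hV]
    congr 1
    ext j
    by_cases hj : j ∈ V
    · simp [y, hj, hab]
    · by_cases hja : x j = a
      · simp [y, hj, hv, hS, hja]
      · simp [y, hj, hv, hS, hja]
  have hcc : ∀ V ⊆ S, ∀ c, c ≠ a → c ≠ b → letterCount (y V) c = letterCount x c := by
    intro V hV c hca hcb
    rw [letterCount, letterCount]
    congr 1
    ext j
    by_cases hj : j ∈ V
    · have := hV hj
      simp only [hS, Finset.mem_filter, Finset.mem_univ, true_and] at this
      have hxj : x j ≠ c := by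
        rcases this with h | h
        · rw [h]; exact hca.symm
        · rw [h]; exact hcb.symm
      simp [y, hj, hxj, hca.symm]
    · by_cases hja : x j = a
      · simp [y, hj, hv, hja, hca.symm, hcb.symm]
      · simp [y, hj, hv, hja]
  have hcard : ∀ V ⊆ S, ∀ V' ⊆ S, V.card = V'.card → F (y V) = F (y V') := by
    intro V hV V' hV' hVV'
    obtain ⟨σ, hσ⟩ := exists_perm_eq_of_letterCount_eq (x := y V) (y := y V') (by
      intro c
      by_cases h1 : c = a
      · rw [h1, hca, hca, hVV']
      by_cases h2 : c = b
      · rw [h2, hcb V hV, hcb V' hV', hVV']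
      rw [hcc V hV c h1 h2, hcc V' hV' c h1 h2])
    rw [hσ, hsymm]
  -- The guard `t ≤ S.card` makes the choice total; larger `t` get no constraint.
  have hex : ∀ t, ∃ V, t ≤ S.card → V ⊆ S ∧ V.card = t := by
    intro t
    by_cases ht : t ≤ S.card
    · obtain ⟨V, hV⟩ := Finset.exists_subset_card_eq ht
      exact ⟨V, fun _ => hV⟩
    · exact ⟨∅, fun h => absurd h ht⟩
  choose V hV using hex
  set h : ℕ → ℝ := fun t => F (y (V t)) with hh
  have hFh : ∀ U ⊆ S, F (y U) = h U.card := by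
    intro U hU
    have := hV U.card (Finset.card_le_card hU)
    exact hcard U hU _ this.1 this.2.symm
  -- Up to sign, the difference of order `k` at `0` is the alternating sum of `F (y U)` over the
  -- subsets `U` of a `k`-element set, which vanishes for `k > d`.
  obtain ⟨p, hp, hph⟩ := exists_polynomial_of_fwdDiff_eq_zero h d S.card (by
    intro k hdk hk
    obtain ⟨hWS, hWc⟩ := hV k hk
    have hzero := sum_powerset_eq_zero_of_mem_degreeLE hdeg (W := V k) (by omega) (fun _ => a) v
    have hzero' : ∑ U ∈ (V k).powerset, (-1 : ℝ) ^ U.card * h U.card = 0 := by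
      apply Complex.ofReal_injective
      rw [Complex.ofReal_zero, ← hzero, Complex.ofReal_sum]
      refine Finset.sum_congr rfl fun U hU => ?_
      rw [← hFh U ((Finset.mem_powerset.1 hU).trans hWS)]
      push_cast
      rfl
    rw [Finset.sum_powerset_apply_card (fun t => (-1 : ℝ) ^ t * h t), hWc] at hzero'
    rw [fwdDiff_iter_eq_sum_shift]
    have : ∑ j ∈ Finset.range (k + 1), ((-1 : ℤ) ^ (k - j) * k.choose j) • h (0 + j • 1) =
        (-1 : ℝ) ^ k * ∑ j ∈ Finset.range (k + 1), k.choose j • ((-1 : ℝ) ^ j * h j) := by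
      rw [Finset.mul_sum]
      refine Finset.sum_congr rfl fun j hj => ?_
      have hjk : j ≤ k := Nat.lt_succ_iff.1 (Finset.mem_range.1 hj)
      have hsign : (-1 : ℝ) ^ (k - j) = (-1) ^ k * (-1) ^ j := by
        conv_rhs => rw [← Nat.sub_add_cancel hjk, pow_add, mul_assoc, ← mul_pow]
        simp
      simp only [zsmul_eq_mul, nsmul_eq_mul, smul_eq_mul, mul_one, zero_add]
      push_cast
      rw [hsign]
      ring
    rw [this, hzero', mul_zero])
  set Y := Finset.univ.filter fun j => x j = a with hY
  have hYS : Y ⊆ S := fun j => by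
    simp only [hY, hS, Finset.mem_filter, Finset.mem_univ, true_and]
    exact Or.inl
  have hiY : i ∈ Y := by simp [hY, ha]
  have hxY : x = y Y := by
    funext j
    by_cases hj : x j = a <;> simp [y, hY, hv, hj]
  have hxY' : Function.update x i b = y (Y.erase i) := by
    funext j
    by_cases hji : j = i
    · subst hji
      simp [y, hv, ← ha]
    · rw [Function.update_of_ne hji]
      refine (congrFun hxY j).trans ?_
      simp [y, Finset.piecewise, hji]
  have hS0 : 0 < S.card := hL0.trans_le hLS
  have hYc := Finset.card_le_card hYS
  have hY1 := Finset.card_erase_le (s := Y) (a := i)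
  have hlip := abs_eval_sub_eval_le_of_nat hp hS0 (hL.trans hLS)
    (fun t ht => by rw [hph t ht]; exact hF _)
    (x := (Y.card : ℝ)) (y := ((Y.erase i).card : ℝ))
    ⟨Nat.cast_nonneg _, Nat.cast_le.2 hYc⟩ ⟨Nat.cast_nonneg _, Nat.cast_le.2 (hY1.trans hYc)⟩
  rw [hph _ hYc, hph _ (hY1.trans hYc), ← hFh _ hYS,
    ← hFh _ ((Finset.erase_subset _ _).trans hYS), ← hxY, ← hxY',
    ← Finset.card_erase_add_one hiY] at hlip
  refine hlip.trans ?_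
  have : |((Y.erase i).card : ℝ) - ((Y.erase i).card + 1 : ℕ)| = 1 := by
    push_cast
    simp
  rw [this, mul_one]
  have hL0' : (0 : ℝ) < L := by exact_mod_cast hL0
  have hLS' : (L : ℝ) ≤ S.card := by exact_mod_cast hLS
  gcongr

/-- The entries are overwritten one at a time; `b` never becomes rarer, so the one-entry bound keeps
applying. -/
theorem abs_piecewise_sub_le {d : ℕ} {F : Input n M → ℝ}
    (hdeg : (fun x => (F x : ℂ)) ∈ degreeLE n M d)
    (hsymm : ∀ x (σ : Equiv.Perm (Fin n)), F (x ∘ σ) = F x) (hF : ∀ x, |F x| ≤ 1)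
    {L : ℕ} (hL0 : 0 < L) (hL : 8 * d ^ 2 ≤ L) (x : Input n M) {b : Fin M}
    (hb : L ≤ letterCount x b) (D : Finset (Fin n)) :
    |F (D.piecewise (fun _ => b) x) - F x| ≤ D.card * (8 * d ^ 2 / L) := by
  classical
  induction D using Finset.induction_on with
  | empty => simp
  | insert i D hi ih =>
    rw [Finset.piecewise_insert, Finset.card_insert_of_notMem hi]
    have hb' : L ≤ letterCount (D.piecewise (fun _ => b) x) b := by
      refine hb.trans (Finset.card_le_card fun j hj => ?_)
      simp only [Finset.mem_filter, Finset.mem_univ, true_and] at hj ⊢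
      by_cases hjD : j ∈ D <;> simp [hjD, hj]
    have h1 := abs_update_sub_le hdeg hsymm hF hL0 hL (D.piecewise (fun _ => b) x) i hb'
    have h2 := abs_sub_le (F (Function.update (D.piecewise (fun _ => b) x) i b))
      (F (D.piecewise (fun _ => b) x)) (F x)
    push_cast
    linarith

/-- A symmetric function of degree at most `d`, bounded by `1`, takes close values at inputs whose
types are close and that share a frequent letter. -/
theorem abs_sub_le_of_letterCount {d : ℕ} {F : Input n M → ℝ}
    (hdeg : (fun x => (F x : ℂ)) ∈ degreeLE n M d)
    (hsymm : ∀ x (σ : Equiv.Perm (Fin n)), F (x ∘ σ) = F x) (hF : ∀ x, |F x| ≤ 1)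
    {L : ℕ} (hL0 : 0 < L) (hL : 8 * d ^ 2 ≤ L) (x y : Input n M) {b : Fin M}
    (hx : L ≤ letterCount x b) (hy : L ≤ letterCount y b) :
    |F x - F y| ≤
      2 * (∑ a, |(letterCount x a : ℝ) - letterCount y a|) * (8 * d ^ 2 / L) := by
  classical
  obtain ⟨σ, hσ⟩ := exists_perm_card_ne_le x y
  set D := Finset.univ.filter fun i => x i ≠ (y ∘ σ) i with hD
  have h1 := abs_piecewise_sub_le hdeg hsymm hF hL0 hL x hx D
  have h2 := abs_piecewise_sub_le hdeg hsymm hF hL0 hL (y ∘ σ)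
    (by rwa [letterCount_comp_perm]) D
  -- Overwriting `D` by `b` erases every disagreement, so both inputs are compared with the same
  -- third one.
  have h3 : D.piecewise (fun _ => b) x = D.piecewise (fun _ => b) (y ∘ σ) := by
    funext i
    by_cases hi : x i = (y ∘ σ) i
    · by_cases hiD : i ∈ D <;> simp [hiD, hi]
    · have hiD : i ∈ D := by simpa [hD] using hi
      simp [hiD]
  rw [hsymm, ← h3] at h2
  rw [abs_sub_comm] at h1
  have h4 := abs_sub_le (F x) (F (D.piecewise (fun _ => b) x)) (F y)
  have h5 : (D.card : ℝ) * (8 * d ^ 2 / L) ≤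
      (∑ a, |(letterCount x a : ℝ) - letterCount y a|) * (8 * d ^ 2 / L) :=
    mul_le_mul_of_nonneg_right hσ (by positivity)
  linarith

end QueryComplexity

/-! ### Randomized algorithms by sampling -/

namespace QueryComplexity

variable {n M : ℕ}

/-- The non-adaptive algorithm that queries the positions `s 0, s 1, …` and applies `g` to the
answers. -/
def sampleTree : (r : ℕ) → (Fin r → Fin n) → ((Fin r → Fin M) → Bool) → DecisionTree n M
  | 0, _, g => .leaf (g Fin.elim0)
  | r + 1, s, g => .query (s 0) fun a => sampleTree r (Fin.tail s) fun w => g (Fin.cons a w)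

theorem eval_sampleTree (r : ℕ) (s : Fin r → Fin n) (g : (Fin r → Fin M) → Bool)
    (x : Input n M) : (sampleTree r s g).eval x = g (x ∘ s) := by
  induction r with
  | zero =>
    simp only [sampleTree, DecisionTree.eval]
    congr 1
    exact Subsingleton.elim _ _
  | succ r ih =>
    simp only [sampleTree, DecisionTree.eval, ih]
    congr 1
    exact Fin.cons_self_tail (x ∘ s)

theorem cost_sampleTree (r : ℕ) (s : Fin r → Fin n) (g : (Fin r → Fin M) → Bool)
    (x : Input n M) : (sampleTree r s g).cost x = r := by
  induction r with
  | zero => rfl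
  | succ r ih => simp only [sampleTree, DecisionTree.cost, ih]

/-- The second moment of a sum of `r` independent centered samples. -/
theorem sum_sq_sum_sample (r : ℕ) (e : Fin n → ℝ) (he : ∑ i, e i = 0) :
    (n : ℝ) * ∑ s : Fin r → Fin n, (∑ j, e (s j)) ^ 2 = r * n ^ r * ∑ i, e i ^ 2 := by
  induction r with
  | zero => simp
  | succ r ih =>
    have h1 : ∑ s : Fin (r + 1) → Fin n, (∑ j, e (s j)) ^ 2 =
        ∑ i, ∑ s : Fin r → Fin n, (e i + ∑ j, e (s j)) ^ 2 := by
      rw [← Fintype.sum_prod_type', ← (Fin.consEquiv fun _ => Fin n).sum_comp]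
      refine Finset.sum_congr rfl fun p _ => ?_
      rw [Fin.sum_univ_succ]
      rfl
    -- The cross terms vanish because `e` sums to zero.
    have h2 : ∑ i, ∑ s : Fin r → Fin n, (e i + ∑ j, e (s j)) ^ 2 =
        n ^ r * ∑ i, e i ^ 2 + n * ∑ s : Fin r → Fin n, (∑ j, e (s j)) ^ 2 := by
      simp only [add_sq, Finset.sum_add_distrib, mul_assoc, ← Finset.mul_sum, Finset.sum_const,
        Finset.card_univ, Fintype.card_fun, Fintype.card_fin, nsmul_eq_mul, Nat.cast_pow,
        ← Finset.sum_mul, he, zero_mul, mul_zero, add_zero]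
    rw [h1, h2, mul_add, ih]
    push_cast
    ring

theorem letterCount_eq_sum (x : Input n M) (a : Fin M) :
    (letterCount x a : ℝ) = ∑ i, if x i = a then 1 else 0 := by
  simp [letterCount]

/-- Chebyshev's inequality for the empirical frequencies of `r` sampled positions. -/
theorem card_bad_samples_mul_le (hn : 0 < n) (x : Input n M) {r : ℕ} (hr : 0 < r) {ε : ℝ}
    (hε : 0 < ε) (bad : Finset (Fin r → Fin n))
    (hbad : ∀ s ∈ bad, ∃ a, ε < |(letterCount (x ∘ s) a : ℝ) / r - letterCount x a / n|) :
    (bad.card : ℝ) * (r * ε ^ 2) ≤ n ^ r := by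
  have hn' : (0 : ℝ) < n := by exact_mod_cast hn
  have hr' : (0 : ℝ) < r := by exact_mod_cast hr
  let e : Fin M → Fin n → ℝ := fun a i => (if x i = a then 1 else 0) - letterCount x a / n
  have he : ∀ a, ∑ i, e a i = 0 := by
    intro a
    simp only [e, Finset.sum_sub_distrib, ← letterCount_eq_sum, Finset.sum_const,
      Finset.card_univ, Fintype.card_fin, nsmul_eq_mul]
    field_simp
    ring
  have hsum : ∀ (s : Fin r → Fin n) a, ∑ j, e a (s j) =
      r * ((letterCount (x ∘ s) a : ℝ) / r - letterCount x a / n) := by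
    intro s a
    rw [letterCount_eq_sum (x ∘ s)]
    simp only [e, Finset.sum_sub_distrib, Function.comp_apply, Finset.sum_const,
      Finset.card_univ, Fintype.card_fin, nsmul_eq_mul]
    field_simp
  -- Summed over all letters the variance is still at most `n`, because the counts sum to `n`. So
  -- all frequencies are controlled at once without a factor `M` from a union bound.
  have hvar : ∑ a, ∑ i, e a i ^ 2 ≤ n := by
    have h1 : ∀ a, ∑ i, e a i ^ 2 ≤ letterCount x a := by
      intro a
      have : ∑ i, e a i ^ 2 = letterCount x a - (letterCount x a : ℝ) ^ 2 / n := by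
        have h2 : ∀ i, e a i ^ 2 = (if x i = a then 1 else 0) * (1 - 2 * (letterCount x a / n)) +
            ((letterCount x a : ℝ) / n) ^ 2 := by
          intro i
          simp only [e]
          split_ifs <;> ring
        simp only [h2, Finset.sum_add_distrib, ← Finset.sum_mul, ← letterCount_eq_sum,
          Finset.sum_const, Finset.card_univ, Fintype.card_fin, nsmul_eq_mul]
        field_simp
        ring
      rw [this]
      have : 0 ≤ (letterCount x a : ℝ) ^ 2 / n := by positivity
      linarith
    calc ∑ a, ∑ i, e a i ^ 2 ≤ ∑ a, (letterCount x a : ℝ) := Finset.sum_le_sum fun a _ => h1 a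
      _ = n := by exact_mod_cast sum_letterCount x
  have htotal : ∑ s : Fin r → Fin n, ∑ a, (∑ j, e a (s j)) ^ 2 ≤ r * n ^ r := by
    rw [Finset.sum_comm]
    have h1 : (n : ℝ) * ∑ a, ∑ s : Fin r → Fin n, (∑ j, e a (s j)) ^ 2 ≤ n * (r * n ^ r) := by
      rw [Finset.mul_sum]
      simp only [fun a => sum_sq_sum_sample r (e a) (he a), ← Finset.mul_sum]
      have : (0 : ℝ) ≤ r * n ^ r := by positivity
      nlinarith
    exact le_of_mul_le_mul_left h1 hn'
  have hlow : (bad.card : ℝ) * (r * ε) ^ 2 ≤ ∑ s : Fin r → Fin n, ∑ a, (∑ j, e a (s j)) ^ 2 := by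
    refine le_trans ?_ (Finset.sum_le_sum_of_subset_of_nonneg (Finset.subset_univ bad)
      fun s _ _ => Finset.sum_nonneg fun a _ => sq_nonneg _)
    rw [← nsmul_eq_mul]
    refine Finset.card_nsmul_le_sum _ _ _ fun s hs => ?_
    obtain ⟨a, ha⟩ := hbad s hs
    refine le_trans ?_ (Finset.single_le_sum (fun a _ => sq_nonneg (∑ j, e a (s j)))
      (Finset.mem_univ a))
    rw [hsum, mul_pow, mul_pow, ← sq_abs (_ / _ - _)]
    gcongr
  have : (r : ℝ) * (bad.card * (r * ε ^ 2)) ≤ r * n ^ r := by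
    calc (r : ℝ) * (bad.card * (r * ε ^ 2)) = bad.card * (r * ε) ^ 2 := by ring
      _ ≤ _ := hlow.trans htotal
  exact le_of_mul_le_mul_left this hr'

/-- If inputs with close types have the same value, then sampling computes the function. -/
theorem R_le_of_separated {X : Set (Input n M)} (f : X → Bool) (hn : 0 < n) {r : ℕ} {ε : ℝ}
    (hε : 0 < ε) (hr : 3 < r * ε ^ 2)
    (hsep : ∀ x y : X, (∀ a, |(letterCount x.1 a : ℝ) / n - letterCount y.1 a / n| ≤ 2 * ε) →
      f x = f y) : R f ≤ r := by
  classical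
  have hr0 : 0 < r := by
    rcases Nat.eq_zero_or_pos r with h | h
    · rw [h] at hr; norm_num at hr
    · exact h
  have : Nonempty (Fin n) := ⟨⟨0, hn⟩⟩
  -- Accept when the empirical type is within `ε` of the type of some `1`-input. On a good sample, a
  -- `0`-input would then be within `2 * ε` of a `1`-input.
  let g : (Fin r → Fin M) → Bool := fun w =>
    decide (∃ y : X, f y = true ∧
      ∀ a, |(letterCount w a : ℝ) / r - letterCount y.1 a / n| ≤ ε)
  refine Nat.sInf_le ⟨(PMF.uniformOfFintype (Fin r → Fin n)).map fun s => sampleTree r s g,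
    fun x => ⟨?_, ?_⟩⟩
  · intro t ht
    rw [PMF.mem_support_map_iff] at ht
    obtain ⟨s, _, rfl⟩ := ht
    rw [cost_sampleTree]
  · set bad : Finset (Fin r → Fin n) := Finset.univ.filter fun s => g (x.1 ∘ s) ≠ f x with hbad
    have hcard := card_bad_samples_mul_le hn x.1 hr0 hε bad (by
      intro s hs
      by_contra! hgood
      refine (Finset.mem_filter.1 hs).2 ?_
      cases hfx : f x with
      | true => exact decide_eq_true ⟨x, hfx, hgood⟩
      | false =>
        refine decide_eq_false ?_
        rintro ⟨y, hy, hclose⟩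
        have := hsep x y fun a => by
          have h1 := hgood a
          have h2 := hclose a
          have h3 := abs_sub_le ((letterCount x.1 a : ℝ) / n)
            ((letterCount (x.1 ∘ s) a : ℝ) / r) (letterCount y.1 a / n)
          rw [abs_sub_comm] at h1
          linarith
        rw [hfx, hy] at this
        exact Bool.false_ne_true this)
    have h3 : 3 * bad.card < n ^ r := by
      have hpos : (0 : ℝ) < n ^ r := by positivity
      have : (3 : ℝ) * bad.card < n ^ r := by
        rcases Nat.eq_zero_or_pos bad.card with h | h
        · rw [h]; simpa using hpos
        · have : (0 : ℝ) < bad.card := by exact_mod_cast h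
          nlinarith
      exact_mod_cast this
    rw [PMF.toOuterMeasure_map_apply]
    have hset : (fun s => sampleTree r s g) ⁻¹' {t : DecisionTree n M | t.eval x ≠ f x} =
        (bad : Set (Fin r → Fin n)) := by
      ext s
      simp [hbad, eval_sampleTree]
    rw [hset, PMF.toOuterMeasure_uniformOfFintype_apply]
    simp only [Finset.coe_sort_coe, Fintype.card_coe, Fintype.card_fun, Fintype.card_fin]
    have hpos : ((n ^ r : ℕ) : ENNReal) ≠ 0 := by
      exact_mod_cast (pow_pos hn r).ne'
    rw [ENNReal.div_lt_iff (Or.inl hpos) (Or.inl (ENNReal.natCast_ne_top _)), one_div,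
      mul_comm, ← div_eq_mul_inv,
      ENNReal.lt_div_iff_mul_lt (Or.inl (by norm_num)) (Or.inl (by norm_num))]
    rw [mul_comm]
    exact_mod_cast h3

end QueryComplexity

/-! ### Combining the two sides -/

namespace QueryComplexity

variable {n M : ℕ}

theorem R_eq_zero_of_forall_eq {X : Set (Input n M)} (f : X → Bool) {b : Bool}
    (h : ∀ x, f x = b) : R f = 0 := by
  refine Nat.le_zero.1 (Nat.sInf_le ⟨PMF.pure (.leaf b), fun x => ⟨?_, ?_⟩⟩)
  · intro t ht
    rw [PMF.support_pure, Set.mem_singleton_iff] at ht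
    rw [ht]
    exact le_rfl
  · rw [PMF.toOuterMeasure_pure_apply, if_neg] <;> simp [DecisionTree.eval, h]

theorem R_le_length {X : Set (Input n M)} (f : X → Bool) : R f ≤ n :=
  Nat.sInf_le (exists_randomizedComputes f)

theorem exists_quantumComputes_Q (hM : 1 ≤ M) {X : Set (Input n M)} (f : X → Bool) :
    ∃ A : QuantumAlgorithm n M, QuantumComputes A (Q f) f :=
  Nat.sInf_mem (s := {T : ℕ | ∃ A : QuantumAlgorithm n M, QuantumComputes A T f})
    ⟨n, exists_quantumComputes hM f⟩

/-- Without queries the output distribution is the same on every input. This covers `Q f = 0`, where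
the upper bound on `R f` is zero. -/
theorem exists_forall_eq_of_Q_eq_zero (hM : 1 ≤ M) {X : Set (Input n M)} (f : X → Bool)
    (hQ : Q f = 0) : ∃ b, ∀ x, f x = b := by
  obtain ⟨A, hA⟩ := exists_quantumComputes_Q hM f
  rw [hQ] at hA
  have hconst : ∀ x y : X, f x = f y := by
    intro x y
    by_contra hne
    have h1 := hA x
    have h2 := hA y
    have h3 := A.prob_true_add_prob_false hM x.1 0
    have hxy : ∀ b, A.prob y.1 0 b = A.prob x.1 0 b := fun b => rfl
    rw [hxy] at h2
    cases hx : f x <;> cases hy : f y <;> simp [hx, hy] at hne h1 h2 <;> linarith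
  by_cases hX : Nonempty X
  · obtain ⟨x⟩ := hX
    exact ⟨f x, fun y => hconst y x⟩
  · exact ⟨true, fun x => (hX ⟨x⟩).elim⟩

theorem exists_letter_le_mul_letterCount (hM : 1 ≤ M) (x : Input n M) :
    ∃ b, n ≤ M * letterCount x b := by
  have : Nonempty (Fin M) := ⟨⟨0, hM⟩⟩
  obtain ⟨b, hb⟩ := Finite.exists_max (letterCount x)
  refine ⟨b, ?_⟩
  calc n = ∑ a, letterCount x a := (sum_letterCount x).symm
    _ ≤ ∑ _a : Fin M, letterCount x b := Finset.sum_le_sum fun a _ => hb a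
    _ = M * letterCount x b := by simp

/-- A symmetric function with small quantum query complexity takes the same value at inputs of
close types. -/
theorem eq_of_letterCount_close (hM : 1 ≤ M) {X : Set (Input n M)} {f : X → Bool}
    (hX : IsSymmetricPromise X) (hf : IsSymmetricFunction f) {q : ℕ} (hq : 1 ≤ q)
    {A : QuantumAlgorithm n M} (hA : QuantumComputes A q f) (hn : 64 * M * q ^ 2 ≤ n)
    {ε : ℝ} (hε : ε = 1 / (1536 * M ^ 2 * q ^ 2)) (x y : X)
    (hxy : ∀ a, |(letterCount x.1 a : ℝ) / n - letterCount y.1 a / n| ≤ 2 * ε) :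
    f x = f y := by
  have hM' : (1 : ℝ) ≤ M := by exact_mod_cast hM
  have hq' : (1 : ℝ) ≤ q := by exact_mod_cast hq
  have hMq : 0 < M * q ^ 2 := by positivity
  have hn0 : 0 < n := by nlinarith
  have hn0' : (0 : ℝ) < n := by exact_mod_cast hn0
  have hεn : 0 ≤ ε * n := by rw [hε]; positivity
  have hclose : ∀ a, |(letterCount x.1 a : ℝ) - letterCount y.1 a| ≤ 2 * (ε * n) := by
    intro a
    have := hxy a
    rw [← sub_div, abs_div, abs_of_pos hn0', div_le_iff₀ hn0'] at this
    linarith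
  obtain ⟨b, hb⟩ := exists_letter_le_mul_letterCount hM x.1
  have hb' : (n : ℝ) ≤ M * letterCount x.1 b := by exact_mod_cast hb
  -- Half of the frequency `1 / M` guaranteed in `x` leaves room for the count of `b` in `y` to be
  -- smaller by `2 * ε * n`. The assumption on `n` gives `L ≥ 32 * q ^ 2 = 8 * (2 * q) ^ 2`, as the
  -- Markov step requires.
  set L := n / (2 * M) with hL
  have hLle : (L : ℝ) * (2 * M) ≤ n := by exact_mod_cast Nat.div_mul_le_self n (2 * M)
  have hL32 : 32 * q ^ 2 ≤ L := by
    rw [hL, Nat.le_div_iff_mul_le (by omega)]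
    linarith
  have hq2 : 1 ≤ q ^ 2 := Nat.one_le_pow _ _ hq
  have hL1 : 1 ≤ L := by omega
  have hL1' : (1 : ℝ) ≤ L := by exact_mod_cast hL1
  have hnL : (n : ℝ) ≤ 4 * M * L := by
    have h1 : n < (L + 1) * (2 * M) := by
      have := Nat.lt_succ_iff.2 (le_refl L)
      exact (Nat.div_lt_iff_lt_mul (by omega)).1 this
    have h2 : (n : ℝ) < (L + 1) * (2 * M) := by exact_mod_cast h1
    nlinarith
  have hεM : 4 * M * (ε * n) ≤ n := by
    have : 4 * M * ε ≤ 1 := by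
      rw [hε, mul_one_div, div_le_one (by positivity)]
      have h1 : (1 : ℝ) ≤ q ^ 2 := one_le_pow₀ hq'
      have h2 : (M : ℝ) ≤ M ^ 2 := by nlinarith
      nlinarith
    nlinarith
  have hLx : L ≤ letterCount x.1 b := by
    have : (L : ℝ) ≤ letterCount x.1 b := by
      by_contra! hlt
      have : (M : ℝ) * letterCount x.1 b < M * L := by gcongr
      nlinarith
    exact_mod_cast this
  have hLy : L ≤ letterCount y.1 b := by
    have h1 := (abs_le.1 (hclose b)).2
    have : (L : ℝ) ≤ letterCount y.1 b := by
      have h2 : (2 * M : ℝ) * L ≤ 2 * M * letterCount y.1 b := by nlinarith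
      exact le_of_mul_le_mul_left h2 (by positivity)
    exact_mod_cast this
  have hdiff := abs_sub_le_of_letterCount (A.symmProb_mem_degreeLE q) (A.symmProb_comp_perm q)
    (A.abs_symmProb_le_one hM q) hL1 (by ring_nf; linarith) x.1 y.1 hLx hLy
  have hsum : ∑ a, |(letterCount x.1 a : ℝ) - letterCount y.1 a| ≤ M * (2 * (ε * n)) := by
    refine (Finset.sum_le_card_nsmul _ _ _ fun a _ => hclose a).trans_eq ?_
    simp
  -- The difference is at most `512 * M ^ 2 * q ^ 2 * ε`, which explains `1536 = 3 * 512`.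
  have hthird : |A.symmProb q x.1 - A.symmProb q y.1| ≤ 1 / 3 := by
    refine hdiff.trans ?_
    have h1 : (8 * ((2 * q : ℕ) : ℝ) ^ 2 / L) ≤ 128 * M * q ^ 2 / n := by
      rw [div_le_div_iff₀ (by linarith) hn0']
      push_cast
      have : (0 : ℝ) ≤ 32 * q ^ 2 := by positivity
      nlinarith
    calc 2 * (∑ a, |(letterCount x.1 a : ℝ) - letterCount y.1 a|) * (8 * ((2 * q : ℕ) : ℝ) ^ 2 / L)
        ≤ 2 * (M * (2 * (ε * n))) * (128 * M * q ^ 2 / n) := by gcongr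
      _ = 1 / 3 := by
        rw [hε]
        have : (M : ℝ) ≠ 0 := by positivity
        have : (q : ℝ) ≠ 0 := by positivity
        field_simp
        norm_num
  have htrue : ∀ z : X, f z = true → 2 / 3 < A.symmProb q z.1 := by
    intro z hz
    refine A.lt_symmProb q z.1 fun σ => ?_
    have h1 := hA ⟨z.1 ∘ σ, hX z.1 z.2 σ⟩
    rw [hf z ⟨z.1 ∘ σ, hX z.1 z.2 σ⟩ σ rfl, hz] at h1
    have := A.prob_true_add_prob_false hM (z.1 ∘ σ) q
    simp only [Bool.not_true] at h1
    linarith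
  have hfalse : ∀ z : X, f z = false → A.symmProb q z.1 < 1 / 3 := by
    intro z hz
    refine A.symmProb_lt q z.1 fun σ => ?_
    have h1 := hA ⟨z.1 ∘ σ, hX z.1 z.2 σ⟩
    rwa [hf z ⟨z.1 ∘ σ, hX z.1 z.2 σ⟩ σ rfl, hz] at h1
  have habs := abs_le.1 hthird
  cases hfx : f x <;> cases hfy : f y
  · rfl
  · linarith [hfalse x hfx, htrue y hfy]
  · linarith [htrue x hfx, hfalse y hfy]
  · rfl

theorem R_le_Q_pow_four_mul (hM : 1 ≤ M) {X : Set (Input n M)} {f : X → Bool}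
    (hX : IsSymmetricPromise X) (hf : IsSymmetricFunction f) :
    R f ≤ 4 * 1536 ^ 2 * (M ^ 4 * Q f ^ 4) := by
  rcases Nat.eq_zero_or_pos (Q f) with hQ | hQ
  · obtain ⟨b, hb⟩ := exists_forall_eq_of_Q_eq_zero hM f hQ
    rw [R_eq_zero_of_forall_eq f hb]
    exact Nat.zero_le _
  obtain ⟨A, hA⟩ := exists_quantumComputes_Q hM f
  rcases le_total (64 * M * Q f ^ 2) n with hn | hn
  · have hM' : (0 : ℝ) < M := by exact_mod_cast hM
    have hQ' : (0 : ℝ) < Q f := by exact_mod_cast hQ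
    refine R_le_of_separated f (ε := 1 / (1536 * M ^ 2 * Q f ^ 2)) ?_ (by positivity) ?_
      fun x y h => eq_of_letterCount_close hM hX hf hQ hA hn rfl x y h
    · have : 0 < 64 * M * Q f ^ 2 := by positivity
      omega
    -- The sample size makes `r * ε ^ 2 = 4`, above the required `3`.
    · have : ((4 * 1536 ^ 2 * (M ^ 4 * Q f ^ 4) : ℕ) : ℝ) * (1 / (1536 * M ^ 2 * Q f ^ 2)) ^ 2
          = 4 := by
        push_cast
        field_simp
        norm_num
      rw [this]
      norm_num
  · have h1 : M ≤ M ^ 4 := Nat.le_self_pow (by norm_num) M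
    have h2 : Q f ^ 2 ≤ Q f ^ 4 := Nat.pow_le_pow_right hQ (by norm_num)
    have h3 : M * Q f ^ 2 ≤ M ^ 4 * Q f ^ 4 := Nat.mul_le_mul h1 h2
    have h4 := R_le_length f
    have h5 : 64 * M * Q f ^ 2 = 64 * (M * Q f ^ 2) := by ring
    omega

theorem R_le_Q_pow_eight_mul (hM : 1 ≤ M) {X : Set (Input n M)} {f : X → Bool}
    (hX : IsSymmetricPromise X) (hf : IsSymmetricFunction f) :
    (R f : ℝ) ≤ 4 * 1536 ^ 2 / Real.log 2 * ((Q f : ℝ) ^ 8 * (M : ℝ) ^ 8 * Real.log M) := by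
  have hlog2 : 0 < Real.log 2 := Real.log_pos (by norm_num)
  -- For `M = 1` the right side vanishes, but there is at most one input. For `M ≥ 2`, dividing by
  -- `Real.log 2` makes the logarithmic factor at least `1`.
  rcases hM.eq_or_lt with rfl | hM2
  · have hconst : ∃ b, ∀ x, f x = b := by
      by_cases h : Nonempty X
      · obtain ⟨x⟩ := h
        exact ⟨f x, fun y => congrArg f (Subsingleton.elim y x)⟩
      · exact ⟨true, fun x => (h ⟨x⟩).elim⟩
    obtain ⟨b, hb⟩ := hconst
    rw [R_eq_zero_of_forall_eq f hb]
    simp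
  · have h1 : (R f : ℝ) ≤ 4 * 1536 ^ 2 * ((M : ℝ) ^ 4 * (Q f : ℝ) ^ 4) := by
      exact_mod_cast R_le_Q_pow_four_mul hM hX hf
    have h2 : (M : ℝ) ^ 4 ≤ (M : ℝ) ^ 8 :=
      pow_le_pow_right₀ (by exact_mod_cast hM) (by norm_num)
    have h3 : (Q f : ℝ) ^ 4 ≤ (Q f : ℝ) ^ 8 := by
      have : Q f ^ 4 ≤ Q f ^ 8 := by
        rcases Nat.eq_zero_or_pos (Q f) with h | h
        · simp [h]
        · exact Nat.pow_le_pow_right h (by norm_num)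
      exact_mod_cast this
    have h4 : 1 ≤ Real.log M / Real.log 2 := by
      rw [one_le_div hlog2]
      exact Real.log_le_log (by norm_num) (by exact_mod_cast hM2)
    calc (R f : ℝ) ≤ 4 * 1536 ^ 2 * ((M : ℝ) ^ 4 * (Q f : ℝ) ^ 4) := h1
      _ ≤ 4 * 1536 ^ 2 * ((M : ℝ) ^ 8 * (Q f : ℝ) ^ 8) := by gcongr
      _ ≤ 4 * 1536 ^ 2 * ((M : ℝ) ^ 8 * (Q f : ℝ) ^ 8) * (Real.log M / Real.log 2) :=
        le_mul_of_one_le_right (by positivity) h4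
      _ = _ := by ring

end QueryComplexity

theorem mainTheorem3 :
    (∃ c : ℝ, 0 < c ∧
      ∀ (M n : ℕ), 2 ≤ M →
      ∀ (X : Set (QueryComplexity.Input n M)) (f : X → Bool),
        QueryComplexity.IsSymmetricPromise X →
        QueryComplexity.IsSymmetricFunction f →
        c * ((QueryComplexity.R f : ℝ) ^ (1 / 8 : ℝ) /
            ((M : ℝ) * (Real.log (M : ℝ)) ^ (1 / 8 : ℝ)))
          ≤ (QueryComplexity.Q f : ℝ)) ∧
    (∃ C : ℝ, 0 < C ∧
      ∀ (M n : ℕ), 1 ≤ M →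
      ∀ (X : Set (QueryComplexity.Input n M)) (f : X → Bool),
        QueryComplexity.IsSymmetricPromise X →
        QueryComplexity.IsSymmetricFunction f →
        (QueryComplexity.R f : ℝ)
          ≤ C * ((QueryComplexity.Q f : ℝ) ^ 8 * (M : ℝ) ^ 8 * Real.log (M : ℝ))) := by
  set C : ℝ := 4 * 1536 ^ 2 / Real.log 2 with hC
  have hC0 : 0 < C := div_pos (by norm_num) (Real.log_pos (by norm_num))
  -- The first inequality is the eighth root of the second.
  refine ⟨⟨(C ^ (1 / 8 : ℝ))⁻¹, by positivity, ?_⟩, C, hC0, fun M n hM X f hX hf =>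
    QueryComplexity.R_le_Q_pow_eight_mul hM hX hf⟩
  intro M n hM X f hX hf
  have hM0 : (0 : ℝ) < M := by positivity
  have hlog : 0 < Real.log M := Real.log_pos (by exact_mod_cast hM)
  have hmain := QueryComplexity.R_le_Q_pow_eight_mul (one_le_two.trans hM) hX hf
  have hroot : (QueryComplexity.R f : ℝ) ^ (1 / 8 : ℝ) ≤
      C ^ (1 / 8 : ℝ) * (QueryComplexity.Q f * M * Real.log M ^ (1 / 8 : ℝ)) := by
    refine (Real.rpow_le_rpow (by positivity) hmain (by norm_num)).trans_eq ?_
    have hpow : ∀ t : ℝ, 0 ≤ t → (t ^ 8) ^ (1 / 8 : ℝ) = t := by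
      intro t ht
      rw [← Real.rpow_natCast, ← Real.rpow_mul ht]
      norm_num
    rw [← hC, Real.mul_rpow hC0.le (by positivity), Real.mul_rpow (by positivity) hlog.le,
      ← mul_pow, hpow _ (by positivity)]
  rw [inv_mul_le_iff₀ (by positivity), div_le_iff₀ (by positivity)]
  linarith
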